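/- Let $K$ be a field, let $\mathscr X$ be a (small) poset regarded as a category, and let $\mathcal C:\mathscr X\to \mathrm{Coalg}_K$ be a functor to $K$-coalgebras which is right coflat: for every $\alpha:x\to y$ in $\mathscr X$, $\mathcal C_x$, regarded as a right $\mathcal C_y$-comodule via $\mathcal C_\alpha$, is coflat, i.e. the cotensor product functor $\mathcal C_x\,\square_{\mathcal C_y}-$ on left $\mathcal C_y$-comodules is exact. For a $K$-coalgebra $C$, a right $C$-contramodule is a $K$-space $M$ with a linear map $\pi_M:\mathrm{Hom}_K(C,M)\to M$ such that $\pi_M(c\mapsto\epsilon(c)m)=m$ for all $m\in M$, and $\pi_M(\pi_M\circ g)=\pi_M(\tilde g\circ\Delta)$ for all linear $g:C\to \mathrm{Hom}_K(C,M)$, where $\tilde g(a\otimes b)=g(a)(b)$; a morphism of contramodules is a linear map commuting with these structure maps. The dual $C^*=\mathrm{Hom}_K(C,K)$ is the free contramodule on $K$, with structure map $g\mapsto \tilde g\circ\Delta$. For a coalgebra map $\alpha:C\to D$, the contrarestriction $\alpha_\bullet$ sends $(M,\pi_M)$ to $M$ with structure map $f\mapsto\pi_M(f\circ\alpha)$,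 and the contraextension is $\alpha^\bullet M=\mathrm{Cohom}_D(C,M)$, the cokernel of the difference of the two maps $\mathrm{Hom}_K(C,\mathrm{Hom}_K(D,M))\rightrightarrows \mathrm{Hom}_K(C,M)$ given by $f\mapsto\tilde f\circ(\mathrm{id}\otimes\alpha)\circ\Delta_C$ and $f\mapsto\pi_M\circ f$, with the $C$-contramodule structure induced by that of $\mathrm{Hom}_K(C,M)$, the free $C$-contramodule on $M$; $\alpha^\bullet$ is left adjoint to $\alpha_\bullet$. A trans-contramodule $\mathcal M$ over $\mathcal C$ consists of a right $\mathcal C_x$-contramodule $\mathcal M_x$ for every $x\in\mathscr X$ and a morphism ${}_\alpha\mathcal M:\mathcal M_y\to\alpha_\bullet\mathcal M_x$ of $\mathcal C_y$-contramodules for every $\alpha:x\to y$, with ${}_{\mathrm{id}}\mathcal M=\mathrm{id}$ and ${}_{\beta\alpha}\mathcal M={}_\alpha\mathcal M\circ{}_\beta\mathcal M$ as maps $\mathcal M_z\to\mathcal M_x$ for $x\xrightarrow{\alpha}y\xrightarrow{\beta}z$; morphisms are families of contramodule morphisms commuting with these maps. It is cartesian if the adjoint morphism ${}^\alpha\mathcal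 M:\alpha^\bullet\mathcal M_y\to\mathcal M_x$ is an isomorphism for every $\alpha:x\to y$. Let $Cont^{tr}_c\text{-}\mathcal C$ be the category of cartesian trans-contramodules (a full subcategory of all trans-contramodules). Put $|\mathcal M|=\sum_{x}|\mathcal M_x|$. Then $Cont^{tr}_c\text{-}\mathcal C$ has a set of generators, i.e. there is a small set $\mathcal G$ of objects such that two parallel morphisms $f,g:\mathcal M\to\mathcal N$ with $fh=gh$ for all $G\in\mathcal G$ and all $h:G\to\mathcal M$ are equal. Moreover, let $\lambda$ be any regular cardinal such that, for every $x\in\mathscr X$, $\mathcal C_x^*$ is $\lambda$-presentable in the category of right $\mathcal C_x$-contramodules, and put $$\kappa=\sup\{\aleph_0,\ |K|,\ \lambda,\ |Mor(\mathscr X)|,\ (|K|^{|Mor(\mathscr X)|})^{|\mathcal C_x|}\ :\ x\in\mathscr X\},\qquad \mu=\sup\{\aleph_0,\ \dim_K\mathcal C_x\ :\ x\in\mathscr X\}.$$ Then for every cartesian trans-contramodule $\mathcal M$, every $x\in\mathscr X$ and every $m\in\mathcal M_x$, there is a cartesian trans-contramodule $\mathcal P\subseteq\mathcal M$ (a subobject,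 with each $\mathcal P_y\to\mathcal M_y$ injective) such that $m\in\mathcal P_x$ and $|\mathcal P|\le\kappa^\mu$. -/

import Mathlib

open CategoryTheory
open scoped TensorProduct

universe u

/-! ## Contramodules over a coalgebra -/

section Contramodules

/-- A right contramodule over a `K`-coalgebra `C`. The identification
`Hom(C, Hom(C, M)) = Hom(C ⊗ C, M)` sends `g` to `a ⊗ b ↦ g a b`
(adjunction of `- ⊗ C` with `Hom(C, -)`). -/
structure Contra (K : Type u) [Field K] (C : Type u) [AddCommGroup C] [Module K C]
    [Coalgebra K C] where
  carrier : Type u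
  [addCommGroup : AddCommGroup carrier]
  [module : Module K carrier]
  /-- the contraction map `π` -/
  contr : (C →ₗ[K] carrier) →ₗ[K] carrier
  contr_counit : ∀ m : carrier,
    contr ((Coalgebra.counit (R := K) (A := C)).smulRight m) = m
  contr_contr : ∀ g : C →ₗ[K] (C →ₗ[K] carrier),
    contr (contr ∘ₗ g) = contr (TensorProduct.lift g ∘ₗ Coalgebra.comul)

attribute [instance] Contra.addCommGroup Contra.module

variable {K : Type u} [Field K]
variable {C : Type u} [AddCommGroup C] [Module K C] [Coalgebra K C]
variable {D : Type u} [AddCommGroup D] [Module K D] [Coalgebra K D]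

instance : CoeSort (Contra K C) (Type u) := ⟨Contra.carrier⟩

namespace Contra

/-- Morphisms of contramodules: linear maps commuting with the contractions. -/
@[ext]
structure Hom (M N : Contra K C) where
  toLin : M →ₗ[K] N
  map_contr : ∀ f : C →ₗ[K] M, toLin (M.contr f) = N.contr (toLin ∘ₗ f)

instance : Category (Contra K C) where
  Hom := Hom
  id M := ⟨LinearMap.id, fun f => by simp⟩
  comp f g := ⟨g.toLin ∘ₗ f.toLin, fun h => by
    simp [f.map_contr, g.map_contr, LinearMap.comp_assoc]⟩

/-- The underlying linear map of a morphism of contramodules. -/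
abbrev lin {M N : Contra K C} (f : M ⟶ N) : M →ₗ[K] N := Hom.toLin f

/-- The free contramodule `T_C(V) = Hom_K(C, V)`. -/
def free (C : Type u) [AddCommGroup C] [Module K C] [Coalgebra K C]
    (V : Type u) [AddCommGroup V] [Module K V] : Contra K C where
  carrier := C →ₗ[K] V
  contr :=
    { toFun := fun g => TensorProduct.lift g ∘ₗ Coalgebra.comul
      map_add' := fun g h => by
        ext c
        simp only [LinearMap.comp_apply, LinearMap.add_apply]
        generalize (Coalgebra.comul c : C ⊗[K] C) = t
        induction t with
        | zero => simp
        | tmul a b => simp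
        | add a b ha hb => rw [map_add, ha, hb, map_add, map_add]; abel
      map_smul' := fun r g => by
        ext c
        simp only [LinearMap.comp_apply, LinearMap.smul_apply, RingHom.id_apply]
        generalize (Coalgebra.comul c : C ⊗[K] C) = t
        induction t with
        | zero => simp
        | tmul a b => simp
        | add a b ha hb => rw [map_add, ha, hb, map_add, smul_add] }
  contr_counit m := by
    ext c
    have h : TensorProduct.lift ((Coalgebra.counit (R := K) (A := C)).smulRight m) =
        m ∘ₗ (TensorProduct.lid K C).toLinearMap ∘ₗ
          (Coalgebra.counit (R := K) (A := C)).rTensor C := by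
      ext a b; simp
    have h2 := congrArg (TensorProduct.lid K C) (Coalgebra.rTensor_counit_comul (R := K) c)
    simp only [LinearMap.coe_mk, AddHom.coe_mk, h, LinearMap.comp_apply, LinearEquiv.coe_coe, h2]
    simp
  contr_contr g := by
    have h : ∀ t : (C ⊗[K] C), TensorProduct.lift
        ((show (C →ₗ[K] C →ₗ[K] V) →ₗ[K] (C →ₗ[K] V) from
          (LinearMap.lcomp K V (Coalgebra.comul (R := K) (A := C))) ∘ₗ
            (TensorProduct.uncurry (RingHom.id K) C C V)) ∘ₗ g) t =
        TensorProduct.lift (TensorProduct.lift g)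
          ((TensorProduct.assoc K C C C).symm
            ((Coalgebra.comul (R := K) (A := C)).lTensor C t)) := by
      intro t
      induction t with
      | zero => simp
      | add a b ha hb => simp only [map_add, ha, hb]
      | tmul a b =>
        simp only [TensorProduct.lift.tmul, LinearMap.comp_apply, LinearMap.lTensor_tmul]
        change TensorProduct.lift (g a) (Coalgebra.comul b) = _
        generalize (Coalgebra.comul b : C ⊗[K] C) = s
        induction s with
        | zero => simp
        | add x y hx hy => simp only [map_add, hx, hy, TensorProduct.tmul_add]
        | tmul x y => simp
    ext c
    change _ = TensorProduct.lift (TensorProduct.lift g ∘ₗ Coalgebra.comul) (Coalgebra.comul c)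
    refine (h (Coalgebra.comul c)).trans ?_
    rw [← Coalgebra.coassoc_apply (R := K) c, LinearEquiv.symm_apply_apply]
    generalize (Coalgebra.comul c : C ⊗[K] C) = t
    induction t with
    | zero => simp
    | tmul a b => simp
    | add a b ha hb => simp only [map_add, ha, hb]

theorem free_contr (V : Type u) [AddCommGroup V] [Module K V]
    (g : C →ₗ[K] (C →ₗ[K] V)) :
    (free C V).contr g = TensorProduct.lift g ∘ₗ Coalgebra.comul := rfl

/-- The dual `C^* = Hom_K(C, K)` as a contramodule. -/
abbrev dual (K : Type u) [Field K] (C : Type u) [AddCommGroup C] [Module K C]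
    [Coalgebra K C] : Contra K C := free C K

theorem exists_section (M : Type u) [AddCommGroup M] [Module K M] (R : Submodule K M) :
    ∃ s : (M ⧸ R) →ₗ[K] M, R.mkQ ∘ₗ s = LinearMap.id :=
  LinearMap.exists_rightInverse_of_surjective _ R.range_mkQ

/-- The contraction on a quotient: lift a map `C → M ⧸ R` to `C → M`, contract, project.
The result does not depend on the lift, see `quotContr_mk`. -/
noncomputable def quotContr (M : Contra K C) (R : Submodule K M) :
    (C →ₗ[K] (M ⧸ R)) →ₗ[K] (M ⧸ R) :=
  R.mkQ ∘ₗ M.contr ∘ₗ LinearMap.llcomp K C (M ⧸ R) M (exists_section M R).choose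

theorem quotContr_mk (M : Contra K C) (R : Submodule K M)
    (hR : ∀ g : C →ₗ[K] M, (∀ c, g c ∈ R) → M.contr g ∈ R) (h : C →ₗ[K] M) :
    quotContr M R (R.mkQ ∘ₗ h) = R.mkQ (M.contr h) := by
  have hs := (exists_section M R).choose_spec
  set s := (exists_section M R).choose with hsdef
  change R.mkQ (M.contr (s ∘ₗ (R.mkQ ∘ₗ h))) = R.mkQ (M.contr h)
  rw [← sub_eq_zero, ← map_sub, ← map_sub, Submodule.mkQ_apply, Submodule.Quotient.mk_eq_zero]
  apply hR
  intro c
  rw [← Submodule.Quotient.mk_eq_zero, ← Submodule.mkQ_apply]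
  have := LinearMap.congr_fun hs (R.mkQ (h c))
  simp only [LinearMap.comp_apply, LinearMap.id_apply] at this
  simp only [LinearMap.sub_apply, LinearMap.comp_apply, map_sub, this, sub_self]

theorem exists_lift {V W : Type u} [AddCommGroup V] [Module K V] [AddCommGroup W] [Module K W]
    (R : Submodule K W) (g : V →ₗ[K] (W ⧸ R)) : ∃ h : V →ₗ[K] W, R.mkQ ∘ₗ h = g := by
  obtain ⟨s, hs⟩ := exists_section W R
  exact ⟨s ∘ₗ g, by rw [← LinearMap.comp_assoc, hs, LinearMap.id_comp]⟩

/-- The quotient of a contramodule by a subcontramodule `R`. -/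
noncomputable def quotient (M : Contra K C) (R : Submodule K M)
    (hR : ∀ g : C →ₗ[K] M, (∀ c, g c ∈ R) → M.contr g ∈ R) : Contra K C where
  carrier := M ⧸ R
  contr := quotContr M R
  contr_counit q := by
    obtain ⟨m, rfl⟩ := R.mkQ_surjective q
    have : (Coalgebra.counit (R := K) (A := C)).smulRight (R.mkQ m) =
        R.mkQ ∘ₗ (Coalgebra.counit (R := K) (A := C)).smulRight m := by ext; simp
    rw [this, quotContr_mk M R hR, M.contr_counit]
  contr_contr g := by
    obtain ⟨s, hs⟩ := exists_section M R
    let h : C →ₗ[K] (C →ₗ[K] M) := LinearMap.llcomp K C (M ⧸ R) M s ∘ₗ g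
    have hg : ∀ c, g c = R.mkQ ∘ₗ h c := fun c => by
      change g c = R.mkQ ∘ₗ (s ∘ₗ g c)
      rw [← LinearMap.comp_assoc, hs, LinearMap.id_comp]
    have h1 : quotContr M R ∘ₗ g = R.mkQ ∘ₗ (M.contr ∘ₗ h) := by
      ext c
      simp only [LinearMap.comp_apply]
      rw [hg c, quotContr_mk M R hR]
    have h2 : TensorProduct.lift g = R.mkQ ∘ₗ TensorProduct.lift h := by
      ext a b
      simp [hg a]
    rw [h1, h2, quotContr_mk M R hR, M.contr_contr, LinearMap.comp_assoc, quotContr_mk M R hR]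

/-- Contrarestriction `α_•` along a coalgebra morphism `α : C → D`. -/
def restr (α : C →ₗc[K] D) (M : Contra K C) : Contra K D where
  carrier := M
  contr := M.contr ∘ₗ LinearMap.lcomp K M α.toLinearMap
  contr_counit m := by
    have : ((Coalgebra.counit (R := K) (A := D)).smulRight m) ∘ₗ α.toLinearMap =
        (Coalgebra.counit (R := K) (A := C)).smulRight m := by
      rw [← α.counit_comp]; ext; simp
    change M.contr (((Coalgebra.counit (R := K) (A := D)).smulRight m) ∘ₗ α.toLinearMap) = m
    rw [this, M.contr_counit]
  contr_contr g := by
    let h : C →ₗ[K] (C →ₗ[K] M) := LinearMap.lcomp K M α.toLinearMap ∘ₗ g ∘ₗ α.toLinearMap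
    have h2 : TensorProduct.lift h =
        TensorProduct.lift g ∘ₗ TensorProduct.map α.toLinearMap α.toLinearMap := by
      ext a b; rfl
    change M.contr (M.contr ∘ₗ h) =
      M.contr ((TensorProduct.lift g ∘ₗ Coalgebra.comul) ∘ₗ α.toLinearMap)
    rw [M.contr_contr, h2, LinearMap.comp_assoc, LinearMap.comp_assoc, α.map_comp_comul]

/-- The right `D`-coaction `(id ⊗ α) ∘ Δ` on `C` induced by `α : C → D`. -/
noncomputable def rightCoact (α : C →ₗc[K] D) : C →ₗ[K] C ⊗[K] D :=
  α.toLinearMap.lTensor C ∘ₗ Coalgebra.comul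

/-- The difference of the two maps
`Hom(C, Hom(D, M)) = Hom(C ⊗ D, M) ⇉ Hom(C, M)`, given by `f ↦ f ∘ ρ` (with `ρ` the right
`D`-coaction on `C`) and `f ↦ π_M ∘ f`, whose cokernel is `Cohom_D(C, M)`. -/
noncomputable def cohomRel (α : C →ₗc[K] D) (M : Contra K D) :
    (C →ₗ[K] (D →ₗ[K] M)) →ₗ[K] (C →ₗ[K] M) :=
  LinearMap.lcomp K M (rightCoact α) ∘ₗ
      (TensorProduct.uncurry (RingHom.id K) C D M)
    - LinearMap.llcomp K C (D →ₗ[K] M) M M.contr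

theorem cohomRel_apply (α : C →ₗc[K] D) (M : Contra K D) (f : C →ₗ[K] (D →ₗ[K] M)) :
    cohomRel α M f = TensorProduct.lift f ∘ₗ rightCoact α - M.contr ∘ₗ f := rfl

theorem cohomRel_closed (α : C →ₗc[K] D) (M : Contra K D) (g : C →ₗ[K] (C →ₗ[K] M))
    (hg : ∀ c, g c ∈ LinearMap.range (cohomRel α M)) :
    (free C M).contr g ∈ LinearMap.range (cohomRel α M) := by
  obtain ⟨h, hh⟩ : ∃ h : C →ₗ[K] (C →ₗ[K] (D →ₗ[K] M)), cohomRel α M ∘ₗ h = g := by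
    obtain ⟨s, hs⟩ := LinearMap.exists_rightInverse_of_surjective
      (cohomRel α M).rangeRestrict (LinearMap.range_rangeRestrict _)
    refine ⟨s ∘ₗ g.codRestrict _ hg, ?_⟩
    ext1 c
    have := congrArg Subtype.val (LinearMap.congr_fun hs (g.codRestrict _ hg c))
    exact this
  refine ⟨TensorProduct.lift h ∘ₗ Coalgebra.comul, ?_⟩
  rw [free_contr, cohomRel_apply]
  ext c
  have key : ∀ t : C ⊗[K] C, TensorProduct.lift g t =
      TensorProduct.lift (TensorProduct.lift h) (α.toLinearMap.lTensor (C ⊗[K] C)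
        ((TensorProduct.assoc K C C C).symm ((Coalgebra.comul (R := K) (A := C)).lTensor C t)))
      - M.contr (TensorProduct.lift h t) := by
    intro t
    induction t with
    | zero => simp
    | add a b ha hb => simp only [map_add, ha, hb]; abel
    | tmul a b =>
      rw [← hh]
      simp only [TensorProduct.lift.tmul, LinearMap.comp_apply, LinearMap.lTensor_tmul,
        cohomRel_apply, LinearMap.sub_apply, rightCoact]
      congr 1
      generalize (Coalgebra.comul b : C ⊗[K] C) = s
      induction s with
      | zero => simp
      | add x y hx hy => simp only [map_add, hx, hy, TensorProduct.tmul_add]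
      | tmul x y => simp
  rw [LinearMap.comp_apply (TensorProduct.lift g), key, ← Coalgebra.coassoc_apply (R := K) c,
    LinearEquiv.symm_apply_apply]
  simp only [LinearMap.sub_apply, LinearMap.comp_apply, rightCoact]
  congr 1
  generalize (Coalgebra.comul c : C ⊗[K] C) = t
  induction t with
  | zero => simp
  | tmul a b => simp
  | add a b ha hb => simp only [map_add, ha, hb]

/-- Contraextension `α^• M = Cohom_D(C, M)`, as a contramodule over `C`: the quotient of
`Hom_K(C, M) = T_C(M)` by the image of the difference of the two structure maps. -/
noncomputable def contraext (α : C →ₗc[K] D) (M : Contra K D) : Contra K C :=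
  quotient (free C M) (LinearMap.range (cohomRel α M)) (cohomRel_closed α M)

/-- The morphism `α^• M → N` adjoint to `φ : M → α_• N`; it sends the class of
`f : C → M` to `π_N (φ ∘ f)`. -/
noncomputable def extDesc (α : C →ₗc[K] D) {M : Contra K D} {N : Contra K C}
    (φ : M ⟶ restr α N) : contraext α M ⟶ N :=
  let φ' : M →ₗ[K] N := lin φ
  let p : (C →ₗ[K] M) →ₗ[K] N := N.contr ∘ₗ LinearMap.llcomp K C M N φ'
  have hp : LinearMap.range (cohomRel α M) ≤ LinearMap.ker p := by
    rintro _ ⟨f, rfl⟩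
    rw [LinearMap.mem_ker, cohomRel_apply, map_sub, sub_eq_zero]
    let h : C →ₗ[K] (C →ₗ[K] N) :=
      LinearMap.lcomp K N α.toLinearMap ∘ₗ LinearMap.llcomp K D M N φ' ∘ₗ f
    have h1 : φ' ∘ₗ (M.contr ∘ₗ f) = N.contr ∘ₗ h := by
      ext c
      exact Hom.map_contr φ (f c)
    have h2 : φ' ∘ₗ (TensorProduct.lift f ∘ₗ rightCoact α) =
        TensorProduct.lift h ∘ₗ Coalgebra.comul := by
      have : φ' ∘ₗ (TensorProduct.lift f ∘ₗ α.toLinearMap.lTensor C) = TensorProduct.lift h := by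
        ext a b; rfl
      rw [← this]; rfl
    change N.contr (φ' ∘ₗ (TensorProduct.lift f ∘ₗ rightCoact α)) =
      N.contr (φ' ∘ₗ (M.contr ∘ₗ f))
    rw [h1, h2, N.contr_contr]
  { toLin := Submodule.liftQ _ p hp
    map_contr := fun g => by
      change C →ₗ[K] ((C →ₗ[K] M) ⧸ LinearMap.range (cohomRel α M)) at g
      obtain ⟨h, rfl⟩ := exists_lift (LinearMap.range (cohomRel α M)) g
      have e := quotContr_mk (free C M) (LinearMap.range (cohomRel α M)) (cohomRel_closed α M) h
      refine (congrArg (Submodule.liftQ (LinearMap.range (cohomRel α M)) p hp) e).trans ?_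
      let k : C →ₗ[K] (C →ₗ[K] N) := LinearMap.llcomp K C M N φ' ∘ₗ h
      have h2 : φ' ∘ₗ TensorProduct.lift h = TensorProduct.lift k := by
        ext a b; rfl
      change N.contr (φ' ∘ₗ (TensorProduct.lift h ∘ₗ Coalgebra.comul)) = N.contr (N.contr ∘ₗ k)
      rw [N.contr_contr, ← LinearMap.comp_assoc, h2] }

end Contra

/-! ## Coflat morphisms of coalgebras -/

/-- A left comodule over a `K`-coalgebra `D`. -/
structure LeftComod (K : Type u) [Field K] (D : Type u) [AddCommGroup D] [Module K D]
    [Coalgebra K D] where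
  carrier : Type u
  [addCommGroup : AddCommGroup carrier]
  [module : Module K carrier]
  coact : carrier →ₗ[K] D ⊗[K] carrier
  coassoc : (TensorProduct.assoc K D D carrier).toLinearMap ∘ₗ
      (Coalgebra.comul (R := K) (A := D)).rTensor carrier ∘ₗ coact = coact.lTensor D ∘ₗ coact
  counit : (TensorProduct.lid K carrier).toLinearMap ∘ₗ
      (Coalgebra.counit (R := K) (A := D)).rTensor carrier ∘ₗ coact = LinearMap.id

attribute [instance] LeftComod.addCommGroup LeftComod.module

instance : CoeSort (LeftComod K D) (Type u) := ⟨LeftComod.carrier⟩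

namespace LeftComod

/-- Morphisms of left comodules. -/
structure Hom (N P : LeftComod K D) where
  toLin : N →ₗ[K] P
  comm : P.coact ∘ₗ toLin = toLin.lTensor D ∘ₗ N.coact

/-- The cotensor product `C □_D N`, for `C` a right `D`-comodule via `α : C → D`. -/
noncomputable def cotensor (α : C →ₗc[K] D) (N : LeftComod K D) : Submodule K (C ⊗[K] N) :=
  LinearMap.eqLocus
    ((TensorProduct.assoc K C D N).toLinearMap ∘ₗ (Contra.rightCoact α).rTensor N)
    (N.coact.lTensor C)

theorem cotensor_map (α : C →ₗc[K] D) {N P : LeftComod K D} (f : Hom N P) :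
    ∀ t ∈ cotensor α N, f.toLin.lTensor C t ∈ cotensor α P := by
  intro t ht
  have ht' : (TensorProduct.assoc K C D N) ((Contra.rightCoact α).rTensor N t) =
      N.coact.lTensor C t := ht
  change (TensorProduct.assoc K C D P) ((Contra.rightCoact α).rTensor P (f.toLin.lTensor C t)) =
      P.coact.lTensor C (f.toLin.lTensor C t)
  rw [← LinearMap.lTensor_comp_apply, f.comm, LinearMap.lTensor_comp_apply, ← ht']
  clear ht ht'
  induction t with
  | zero => simp
  | add a b ha hb => simp only [map_add, ha, hb]
  | tmul c n =>
    simp only [LinearMap.lTensor_tmul, LinearMap.rTensor_tmul]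
    generalize Contra.rightCoact α c = s
    induction s with
    | zero => simp
    | add x y hx hy => simp only [map_add, hx, hy, TensorProduct.add_tmul]
    | tmul x y => simp

/-- The map `C □_D f : C □_D N → C □_D P`. -/
noncomputable def cotensorMap (α : C →ₗc[K] D) {N P : LeftComod K D} (f : Hom N P) :
    cotensor α N →ₗ[K] cotensor α P :=
  (f.toLin.lTensor C).restrict (cotensor_map α f)

end LeftComod

/-- `α : C → D` is right coflat: `C` is coflat as a right `D`-comodule, i.e. the functor
`C □_D -` on left `D`-comodules preserves exact sequences. -/
def RightCoflat (α : C →ₗc[K] D) : Prop :=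
  ∀ (N P Q : LeftComod K D) (f : LeftComod.Hom N P) (g : LeftComod.Hom P Q),
    Function.Exact f.toLin g.toLin →
    Function.Exact (LeftComod.cotensorMap α f) (LeftComod.cotensorMap α g)

end Contramodules

/-! ## Trans-contramodules over a coalgebra representation -/

section Representations

variable {K : Type u} [Field K] {X : Type u} [SmallCategory X]

/-- A right trans-contramodule over a coalgebra representation `F : X ⥤ Coalg`. -/
structure TransContra (F : X ⥤ CoalgCat.{u} K) where
  obj : ∀ x : X, Contra K (F.obj x)
  /-- the structure morphism `M_y → α_• M_x` for `α : x → y` -/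
  map : ∀ {x y : X} (α : x ⟶ y), obj y ⟶ Contra.restr (F.map α).toCoalgHom (obj x)
  map_id : ∀ (x : X) (m : obj x), Contra.lin (map (𝟙 x)) m = m
  map_comp : ∀ {x y z : X} (α : x ⟶ y) (β : y ⟶ z) (m : obj z),
    Contra.lin (map (α ≫ β)) m = Contra.lin (map α) (Contra.lin (map β) m)

namespace TransContra

variable {F : X ⥤ CoalgCat.{u} K}

/-- Morphisms of trans-contramodules. -/
@[ext]
structure Hom (M N : TransContra F) where
  app : ∀ x : X, M.obj x ⟶ N.obj x
  naturality : ∀ {x y : X} (α : x ⟶ y) (m : M.obj y),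
    Contra.lin (N.map α) (Contra.lin (app y) m) = Contra.lin (app x) (Contra.lin (M.map α) m)

instance : Category (TransContra F) where
  Hom := Hom
  id M := ⟨fun x => 𝟙 (M.obj x), fun _ _ => rfl⟩
  comp f g := ⟨fun x => f.app x ≫ g.app x, fun {_ y} α m =>
    (g.naturality α (Contra.lin (f.app y) m)).trans
      (congrArg _ (f.naturality α m))⟩

/-- `M` is cartesian if `α^• M_y → M_x` is an isomorphism of contramodules for all
`α : x → y`. -/
def IsCartesian (M : TransContra F) : Prop :=
  ∀ {x y : X} (α : x ⟶ y), IsIso (Contra.extDesc (F.map α).toCoalgHom (M.map α))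

/-- The cardinality of `M`, i.e. of the disjoint union of the sets `M_x`. -/
def card (M : TransContra F) : Cardinal.{u} := Cardinal.mk (Σ x : X, M.obj x)

end TransContra

/-- The full subcategory of cartesian trans-contramodules. -/
abbrev CartTransContra (F : X ⥤ CoalgCat.{u} K) : Type (u + 1) :=
  ObjectProperty.FullSubcategory (fun M : TransContra F => M.IsCartesian)

/-- A right coflat representation. -/
def RightCoflatRep (F : X ⥤ CoalgCat.{u} K) : Prop :=
  ∀ {x y : X} (α : x ⟶ y), RightCoflat (F.map α).toCoalgHom

/-- The cardinality of the set of all morphisms of `X`. -/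
def cardMor (X : Type u) [SmallCategory X] : Cardinal.{u} :=
  Cardinal.mk (Σ p : X × X, (p.1 ⟶ p.2))

/-- `κ = sup {ℵ₀, |K|, lam, |Mor X|, (|K| ^ |Mor X|) ^ |C_x| : x ∈ X}`. -/
noncomputable def kappa (F : X ⥤ CoalgCat.{u} K) (lam : Cardinal.{u}) : Cardinal.{u} :=
  max (max (max Cardinal.aleph0 (Cardinal.mk K)) (max lam (cardMor X)))
    (⨆ x : X, (Cardinal.mk K ^ cardMor X) ^ Cardinal.mk (F.obj x))

/-- `μ = sup {ℵ₀, dim C_x : x ∈ X}`. -/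
noncomputable def mu (F : X ⥤ CoalgCat.{u} K) : Cardinal.{u} :=
  max Cardinal.aleph0 (⨆ x : X, Module.rank K (F.obj x))

end Representations

/-! ### Cartesianness as solvability of linear equations. -/

namespace Contra

section

variable {K : Type u} [Field K]
variable {C : Type u} [AddCommGroup C] [Module K C] [Coalgebra K C]
variable {D : Type u} [AddCommGroup D] [Module K D] [Coalgebra K D]

/-! The argument is of downward Löwenheim–Skolem type. By `isIso_extDesc_iff`, being cartesian is a
family of existential conditions: for `α : x → y`, every `n` in `M_x` equals `π (M_α ∘ f)` for some
`f : C_x → M_y`, and every `f` for which this expression vanishes comes from some `h : C_x →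
Hom(C_y, M_y)` via `cohomRel`. Choose solutions once and for all. A linear map out of `C_x` is given
by its values on a basis, so the chosen solutions become operations on elements of `M`, each taking
at most `μ` arguments.

A family of subspaces closed under these operations satisfies the same conditions (`IsCartClosed`).
Since `K` is a field, linear maps with values in a subspace factor through it, so the family carries
a cartesian structure (`isCartesian_induced`).

The closure of one element consists of values of well-founded terms, counted by a W-type: there are
at most `κ ^ μ` operations of arity at most `μ`, and `(κ ^ μ) ^ μ = κ ^ μ`, hence at most `κ ^ μ`
terms (`exists_closed_family`). This proves the size bound. For generators, copy the small
subobjects onto subsets of one fixed set of cardinality `κ ^ μ`; the cartesian structures on such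
subsets form a small set, and their images cover every `M`. -/

theorem isIso_of_bijective {M N : Contra K C} (f : M ⟶ N)
    (hf : Function.Bijective (lin f)) : IsIso f := by
  let e : M ≃ₗ[K] N := LinearEquiv.ofBijective (lin f) hf
  have he : ∀ n, lin f (e.symm n) = n := e.apply_symm_apply
  have he' : ∀ m, e.symm (lin f m) = m := e.symm_apply_apply
  refine ⟨⟨⟨e.symm.toLinearMap, fun g => ?_⟩, ?_, ?_⟩⟩
  · apply hf.1
    refine (he _).trans ?_
    refine Eq.trans ?_ (Hom.map_contr f _).symm
    congr 1
    ext c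
    exact (he _).symm
  · exact Hom.ext (LinearMap.ext he')
  · exact Hom.ext (LinearMap.ext he)

theorem bijective_of_isIso {M N : Contra K C} (f : M ⟶ N) [IsIso f] :
    Function.Bijective (lin f) := by
  refine Function.bijective_iff_has_inverse.2 ⟨lin (inv f), fun m => ?_, fun n => ?_⟩
  · exact LinearMap.congr_fun (congrArg lin (IsIso.hom_inv_id f)) m
  · exact LinearMap.congr_fun (congrArg lin (IsIso.inv_hom_id f)) n

/-- The map `f ↦ π_N (φ ∘ f)` underlying the morphism adjoint to `φ`. -/
abbrev extMap (α : C →ₗc[K] D) {M : Contra K D} {N : Contra K C} (φ : M ⟶ restr α N)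
    (f : C →ₗ[K] M) : N :=
  N.contr ((show M →ₗ[K] N from lin φ) ∘ₗ f)

/-- The contraextension is the quotient of `Hom(C, M)` by the range of `cohomRel`, and `extMap` is
the adjoint morphism read on representatives. The two conditions are its surjectivity and
injectivity, freed of quotients so that solutions can be chosen. -/
theorem isIso_extDesc_iff (α : C →ₗc[K] D) {M : Contra K D} {N : Contra K C}
    (φ : M ⟶ restr α N) :
    IsIso (extDesc α φ) ↔ (∀ n, ∃ f, extMap α φ f = n) ∧
      ∀ f, extMap α φ f = 0 → ∃ h, cohomRel α M h = f := by
  constructor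
  · intro _
    have hb := bijective_of_isIso (extDesc α φ)
    refine ⟨fun n => ?_, fun f hf => ?_⟩
    · obtain ⟨q, hq⟩ := hb.2 n
      obtain ⟨f, rfl⟩ := Submodule.Quotient.mk_surjective
        (LinearMap.range (cohomRel α M)) q
      exact ⟨f, hq⟩
    · have : (Submodule.Quotient.mk f : (C →ₗ[K] M) ⧸ LinearMap.range (cohomRel α M)) = 0 :=
        hb.1 (hf.trans (map_zero (lin (extDesc α φ))).symm)
      exact (Submodule.Quotient.mk_eq_zero _).1 this
  · rintro ⟨hs, hi⟩
    refine isIso_of_bijective _ ⟨?_, fun n => ?_⟩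
    · refine (injective_iff_map_eq_zero (lin (extDesc α φ))).2 fun q hq => ?_
      obtain ⟨f, rfl⟩ := Submodule.Quotient.mk_surjective
        (LinearMap.range (cohomRel α M)) q
      exact (Submodule.Quotient.mk_eq_zero _).2 (hi f hq)
    · obtain ⟨f, hf⟩ := hs n
      exact ⟨Submodule.Quotient.mk f, hf⟩

end

section

variable {K : Type u} [Field K]

/-- Over a field, `j` has a linear section over its range. This moves solutions from the ambient
space into a subspace. -/
theorem exists_comp_eq {U V W : Type u} [AddCommGroup U] [Module K U] [AddCommGroup V]
    [Module K V] [AddCommGroup W] [Module K W] {j : V →ₗ[K] W} (f : U →ₗ[K] W)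
    (hf : ∀ u, f u ∈ LinearMap.range j) : ∃ g : U →ₗ[K] V, j ∘ₗ g = f := by
  obtain ⟨s, hs⟩ := LinearMap.exists_rightInverse_of_surjective
    j.rangeRestrict (LinearMap.range_rangeRestrict _)
  refine ⟨s ∘ₗ f.codRestrict _ hf, ?_⟩
  ext c
  exact congrArg Subtype.val (LinearMap.congr_fun hs (f.codRestrict _ hf c))

variable {C : Type u} [AddCommGroup C] [Module K C] [Coalgebra K C]

/-- The contraction induced on a `K`-space embedded in a contramodule as a subspace closed
under contraction. -/
noncomputable def inducedContr (M : Contra K C) {V : Type u} [AddCommGroup V] [Module K V]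
    (j : V →ₗ[K] M) (hj : Function.Injective j)
    (h : ∀ g : C →ₗ[K] V, M.contr (j ∘ₗ g) ∈ LinearMap.range j) : (C →ₗ[K] V) →ₗ[K] V :=
  (LinearEquiv.ofInjective j hj).symm.toLinearMap ∘ₗ
    (M.contr ∘ₗ LinearMap.llcomp K C V M j).codRestrict (LinearMap.range j) h

theorem inducedContr_apply (M : Contra K C) {V : Type u} [AddCommGroup V] [Module K V]
    (j : V →ₗ[K] M) (hj : Function.Injective j)
    (h : ∀ g : C →ₗ[K] V, M.contr (j ∘ₗ g) ∈ LinearMap.range j) (g : C →ₗ[K] V) :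
    j (inducedContr M j hj h g) = M.contr (j ∘ₗ g) :=
  congrArg Subtype.val ((LinearEquiv.ofInjective j hj).apply_symm_apply ⟨_, h g⟩)

/-- The contramodule structure induced on a `K`-space embedded in a contramodule as a subspace
closed under contraction. -/
noncomputable def induced (M : Contra K C) {V : Type u} [AddCommGroup V] [Module K V]
    (j : V →ₗ[K] M) (hj : Function.Injective j)
    (h : ∀ g : C →ₗ[K] V, M.contr (j ∘ₗ g) ∈ LinearMap.range j) : Contra K C where
  carrier := V
  contr := inducedContr M j hj h
  contr_counit v := by
    apply hj
    rw [inducedContr_apply, ← M.contr_counit (j v)]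
    congr 1
    ext c
    simp
  contr_contr g := by
    apply hj
    rw [inducedContr_apply, inducedContr_apply]
    have h1 : j ∘ₗ (inducedContr M j hj h ∘ₗ g) =
        M.contr ∘ₗ (LinearMap.llcomp K C V M j ∘ₗ g) :=
      LinearMap.ext fun c => inducedContr_apply M j hj h (g c)
    have h2 : j ∘ₗ TensorProduct.lift g =
        TensorProduct.lift (LinearMap.llcomp K C V M j ∘ₗ g) := by
      ext a b; rfl
    rw [h1, M.contr_contr, ← LinearMap.comp_assoc, h2]

end

end Contra

/-! ### Closed families of subspaces and the trans-contramodules they carry. -/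

namespace TransContra

section

variable {K : Type u} [Field K] {X : Type u} [SmallCategory X] {F : X ⥤ CoalgCat.{u} K}

/-- A family of subspaces of a trans-contramodule which is closed under the structure maps, and
over which the equations expressing that the trans-contramodule is cartesian can be solved. -/
structure IsCartClosed (M : TransContra F) (S : ∀ x, Submodule K (M.obj x)) : Prop where
  contr_mem : ∀ (x : X) (g : F.obj x →ₗ[K] M.obj x), (∀ c, g c ∈ S x) →
    (M.obj x).contr g ∈ S x
  map_mem : ∀ {x y : X} (α : x ⟶ y) (m : M.obj y), m ∈ S y →
    (Contra.lin (M.map α) m : M.obj x) ∈ S x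
  exists_extMap : ∀ {x y : X} (α : x ⟶ y) (n : M.obj x), n ∈ S x →
    ∃ f : F.obj x →ₗ[K] M.obj y, (∀ c, f c ∈ S y) ∧
      Contra.extMap (F.map α).toCoalgHom (M.map α) f = n
  exists_cohomRel : ∀ {x y : X} (α : x ⟶ y) (f : F.obj x →ₗ[K] M.obj y), (∀ c, f c ∈ S y) →
    Contra.extMap (F.map α).toCoalgHom (M.map α) f = 0 →
    ∃ h : F.obj x →ₗ[K] F.obj y →ₗ[K] M.obj y, (∀ c d, h c d ∈ S y) ∧
      Contra.cohomRel (F.map α).toCoalgHom (M.obj y) h = f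

/-! ### Structure on `V x ≃ S x`: `V` may be `S` itself (subobjects) or a copy on a fixed set
(generators). -/

section Induced

variable {M : TransContra F} {S : ∀ x, Submodule K (M.obj x)} (hS : M.IsCartClosed S)
  {V : X → Type u} [∀ x, AddCommGroup (V x)] [∀ x, Module K (V x)] (e : ∀ x, V x ≃ₗ[K] S x)

/-- The embedding `V x ≃ S x ⊆ M x`. -/
abbrev incl (x : X) : V x →ₗ[K] M.obj x := (S x).subtype ∘ₗ (e x).toLinearMap

theorem incl_injective (x : X) : Function.Injective (incl e x) :=
  (S x).injective_subtype.comp (e x).injective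

theorem range_incl (x : X) : LinearMap.range (incl e x) = S x := by
  rw [LinearMap.range_comp, LinearEquiv.range, Submodule.map_top, Submodule.range_subtype]

/-- The contramodule structures on the `V x`. -/
noncomputable abbrev inducedObj (x : X) : Contra K (F.obj x) :=
  (M.obj x).induced (incl e x) (incl_injective e x) fun g => by
    rw [range_incl]
    exact hS.contr_mem x _ fun c => (e x (g c)).2

/-- The structure morphisms of the induced trans-contramodule. -/
noncomputable def inducedMap {x y : X} (α : x ⟶ y) : V y →ₗ[K] V x :=
  (e x).symm.toLinearMap ∘ₗ LinearMap.codRestrict (S x)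
    ((show M.obj y →ₗ[K] M.obj x from Contra.lin (M.map α)) ∘ₗ incl e y)
    fun v => hS.map_mem α _ (e y v).2

theorem incl_inducedMap {x y : X} (α : x ⟶ y) (v : V y) :
    incl e x (inducedMap hS e α v) = Contra.lin (M.map α) (incl e y v) :=
  congrArg Subtype.val ((e x).apply_symm_apply _)

/-- The trans-contramodule structure on a family of spaces identified with a closed family of
subspaces. -/
noncomputable def induced : TransContra F where
  obj x := inducedObj hS e x
  map {x y} α :=
    { toLin := inducedMap hS e α
      map_contr := fun f => by
        apply incl_injective e x
        refine (incl_inducedMap hS e α _).trans ?_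
        refine (congrArg (Contra.lin (M.map α))
          (Contra.inducedContr_apply (M.obj y) (incl e y) _ _ f)).trans ?_
        refine (Contra.Hom.map_contr (M.map α) _).trans ?_
        refine Eq.trans ?_ (Contra.inducedContr_apply (M.obj x) (incl e x)
          (incl_injective e x) _ _).symm
        refine congrArg (M.obj x).contr ?_
        ext c
        exact (incl_inducedMap hS e α _).symm }
  map_id x m := incl_injective e x ((incl_inducedMap hS e _ m).trans (M.map_id x _))
  map_comp {x y z} α β m := by
    apply incl_injective e x
    refine (incl_inducedMap hS e (α ≫ β) m).trans ((M.map_comp α β (incl e z m)).trans ?_)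
    refine Eq.trans ?_ (incl_inducedMap hS e α _).symm
    exact congrArg (Contra.lin (M.map α)) (incl_inducedMap hS e β m).symm

/-- The embedding of the induced trans-contramodule. -/
noncomputable def inducedIncl : induced hS e ⟶ M where
  app x :=
    { toLin := incl e x
      map_contr := fun f => Contra.inducedContr_apply (M.obj x) (incl e x) _ _ f }
  naturality α m := (incl_inducedMap hS e α m).symm

/-- Together with `incl_cohomRel`, this turns the cartesian conditions for the induced structure
into equations in `M` with unknowns taking values in `S`. -/
theorem incl_extMap {x y : X} (α : x ⟶ y) (f : F.obj x →ₗ[K] V y) :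
    incl e x (Contra.extMap (F.map α).toCoalgHom ((induced hS e).map α) f) =
      Contra.extMap (F.map α).toCoalgHom (M.map α) (incl e y ∘ₗ f) := by
  refine (Contra.inducedContr_apply (M.obj x) (incl e x) _ _ _).trans ?_
  refine congrArg (M.obj x).contr ?_
  ext c
  exact incl_inducedMap hS e α _

theorem incl_cohomRel {x y : X} (α : x ⟶ y) (h : F.obj x →ₗ[K] F.obj y →ₗ[K] V y) :
    incl e y ∘ₗ Contra.cohomRel (F.map α).toCoalgHom ((induced hS e).obj y) h =
      Contra.cohomRel (F.map α).toCoalgHom (M.obj y)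
        (LinearMap.llcomp K (F.obj y) (V y) (M.obj y) (incl e y) ∘ₗ h) := by
  ext c
  refine (map_sub (incl e y) (TensorProduct.lift h (Contra.rightCoact _ c))
    (((induced hS e).obj y).contr (h c))).trans ?_
  refine congrArg₂ (fun a b : M.obj y => a - b) ?_ ?_
  · have h2 : incl e y ∘ₗ TensorProduct.lift h =
        TensorProduct.lift (LinearMap.llcomp K (F.obj y) (V y) (M.obj y) (incl e y) ∘ₗ h) := by
      ext a b; rfl
    exact LinearMap.congr_fun h2 _
  · exact Contra.inducedContr_apply (M.obj y) (incl e y) _ _ _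

theorem isCartesian_induced : (induced hS e).IsCartesian := by
  intro x y α
  refine (Contra.isIso_extDesc_iff _ _).2 ⟨fun n => ?_, fun f hf => ?_⟩
  · obtain ⟨f, hf, hfn⟩ := hS.exists_extMap α (incl e x n) (e x n).2
    obtain ⟨g, rfl⟩ := Contra.exists_comp_eq (j := incl e y) f
      (by rw [range_incl]; exact hf)
    exact ⟨g, incl_injective e x ((incl_extMap hS e α g).trans hfn)⟩
  · obtain ⟨h, hh, hhf⟩ := hS.exists_cohomRel α (incl e y ∘ₗ f) (fun c => (e y (f c)).2)
      ((incl_extMap hS e α f).symm.trans ((congrArg (incl e x) hf).trans (map_zero _)))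
    -- Two successive factorizations: each `h c` factors through `V y`; hence `h` takes values in
    -- the range of postcomposition with `incl e y`, and so factors linearly through it.
    choose g hg using fun c => Contra.exists_comp_eq (j := incl e y) (h c)
      (by rw [range_incl]; exact hh c)
    obtain ⟨k, hk⟩ := Contra.exists_comp_eq
      (j := LinearMap.llcomp K (F.obj y) (V y) (M.obj y) (incl e y)) h
      (fun c => ⟨g c, hg c⟩)
    refine ⟨k, LinearMap.ext fun c => incl_injective e y ?_⟩
    refine (LinearMap.congr_fun (incl_cohomRel hS e α k) c).trans ?_
    rw [hk, hhf]
    rfl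

end Induced

end

end TransContra

/-! ### Closing under operations of bounded arity, with a cardinality bound. -/

open Cardinal in
/-- A family of types with operations of bounded arity contains a small subfamily closed under
the operations. -/
theorem exists_closed_family {X : Type u} (M : X → Type u) [∀ x, Zero (M x)] {A : Type u}
    (β : A → Type u) (src tgt : A → X) (op : ∀ a, (β a → M (src a)) → M (tgt a))
    {κ μ : Cardinal.{u}} (hA : #A ≤ κ) (hβ : ∀ a, #(β a) ≤ μ) (hκμ : κ ^ μ ≤ κ) (hκ : ℵ₀ ≤ κ) :
    ∃ T : ∀ x, Set (M x), #(Σ x, T x) ≤ κ ∧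
      ∀ a f, (∀ b, f b ∈ T (src a)) → op a f ∈ T (tgt a) := by
  classical
  -- Terms in `WType β` carry no sorts. An argument of the wrong sort is read as `0`, so that
  -- evaluation is total; on arguments of the right sort `r` changes nothing.
  let r : ∀ y, (Σ x, M x) → M y := fun y s => if h : s.1 = y then h ▸ s.2 else 0
  have hr : ∀ y (m : M y), r y ⟨y, m⟩ = m := fun y m => by simp [r]
  let ev : WType β → Σ x, M x :=
    WType.elim _ fun p => ⟨tgt p.1, op p.1 fun b => r (src p.1) (p.2 b)⟩
  -- The W-type is the initial algebra of its signature, so its cardinality is bounded by any `κ`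
  -- with `∑ κ ^ #(β a) ≤ κ`.
  have hcard : #(WType β) ≤ κ := by
    apply WType.cardinalMk_le_of_le
    calc (Cardinal.sum fun a => κ ^ #(β a)) ≤ Cardinal.sum fun _ : A => κ :=
          Cardinal.sum_le_sum _ _ fun a =>
            (Cardinal.power_le_power_left (aleph0_pos.trans_le hκ).ne' (hβ a)).trans hκμ
      _ = #A * κ := Cardinal.sum_const' _ _
      _ ≤ κ := Cardinal.mul_le_of_le hκ hA le_rfl
  refine ⟨fun x => {m | (⟨x, m⟩ : Σ x, M x) ∈ Set.range ev}, ?_, ?_⟩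
  · refine le_trans ?_ ((mk_range_le (f := ev)).trans hcard)
    refine Cardinal.mk_le_of_injective (f := fun s => ⟨⟨s.1, s.2.1⟩, s.2.2⟩) ?_
    rintro ⟨x, m, hm⟩ ⟨y, n, hn⟩ h
    simp only [Subtype.mk.injEq, Sigma.mk.injEq] at h
    obtain ⟨rfl, h⟩ := h
    obtain rfl := eq_of_heq h
    rfl
  · intro a f hf
    -- Each argument is the value of some term; `op a` applied to these values is the value of the
    -- compound term.
    choose w hw using hf
    refine ⟨WType.mk a w, ?_⟩
    change (⟨tgt a, op a fun b => r (src a) (ev (w b))⟩ : Σ x, M x) = ⟨tgt a, op a f⟩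
    simp only [hw, hr]

/-- Allows an operation to return a linear map through its basis values, one symbol per basis
vector. -/
theorem LinearMap.apply_mem_of_basis {K C M ι : Type*} [Field K] [AddCommGroup C] [Module K C]
    [AddCommGroup M] [Module K M] (b : Module.Basis ι K C) (f : C →ₗ[K] M) (S : Submodule K M)
    (h : ∀ i, f (b i) ∈ S) (c : C) : f c ∈ S := by
  have : ⊤ ≤ S.comap f := by
    rw [← b.span_eq, Submodule.span_le]
    rintro _ ⟨i, rfl⟩
    exact h i
  exact this Submodule.mem_top

/-! ### The operations for the cartesian conditions, and the closure they generate. -/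

namespace TransContra

/-- Symbols for the operations generating a closed family of subspaces. -/
inductive Sym (K : Type u) {X : Type u} [SmallCategory X] (B : X → Type u) : Type u
  | const (x : X)
  | comb (x : X) (r s : K)
  | ext (a : Σ p : X × X, (p.1 ⟶ p.2))
  | lift (a : Σ p : X × X, (p.1 ⟶ p.2)) (i : B a.1.1)
  | rel (a : Σ p : X × X, (p.1 ⟶ p.2)) (i : B a.1.1) (j : B a.1.2)

namespace Sym

section

variable {K : Type u} {X : Type u} [SmallCategory X] {B : X → Type u}

/-- The arity of an operation. -/
def arity : Sym K B → Type u
  | const _ => PEmpty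
  | comb _ _ _ => ULift Bool
  | ext a => B a.1.1
  | lift _ _ => PUnit
  | rel a _ _ => B a.1.1

/-- The sort of the arguments of an operation. -/
def src : Sym K B → X
  | const x => x
  | comb x _ _ => x
  | ext a => a.1.2
  | lift a _ => a.1.1
  | rel a _ _ => a.1.2

/-- The sort of the value of an operation. -/
def tgt : Sym K B → X
  | const x => x
  | comb x _ _ => x
  | ext a => a.1.1
  | lift a _ => a.1.2
  | rel a _ _ => a.1.2

open Cardinal in
theorem mk_arity_le {μ : Cardinal.{u}} (hμ : ℵ₀ ≤ μ) (hB : ∀ x, #(B x) ≤ μ) :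
    ∀ a : Sym K B, #a.arity ≤ μ
  | const _ => by simp [arity]
  | comb _ _ _ => (mk_lt_aleph0_iff.2 (inferInstanceAs (Finite (ULift Bool)))).le.trans hμ
  | ext a => hB _
  | lift _ _ => (mk_lt_aleph0_iff.2 (inferInstanceAs (Finite PUnit))).le.trans hμ
  | rel a _ _ => hB _

open Cardinal in
theorem mk_sigma_le {ι : Type u} {f : ι → Type u} {κ : Cardinal.{u}} (hκ : ℵ₀ ≤ κ)
    (hι : #ι ≤ κ) (hf : ∀ i, #(f i) ≤ κ) : #(Σ i, f i) ≤ κ := by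
  rw [mk_sigma]
  refine (Cardinal.sum_le_sum _ (fun _ => κ) hf).trans ?_
  rw [Cardinal.sum_const']
  exact mul_le_of_le hκ hι le_rfl

theorem mk_le_cardMor : Cardinal.mk X ≤ cardMor X :=
  Cardinal.mk_le_of_injective (f := fun x => ⟨(x, x), 𝟙 x⟩) fun _ _ h =>
    congrArg (fun s : Σ p : X × X, (p.1 ⟶ p.2) => s.1.1) h

open Cardinal in
theorem mk_le {κ : Cardinal.{u}} (hκ : ℵ₀ ≤ κ) (hK : #K ≤ κ) (hX : cardMor X ≤ κ)
    (hB : ∀ x, #(B x) ≤ κ) : #(Sym K B) ≤ κ := by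
  let φ : X ⊕ (X × K × K) ⊕ (Σ p : X × X, (p.1 ⟶ p.2)) ⊕
      (Σ a : (Σ p : X × X, (p.1 ⟶ p.2)), B a.1.1) ⊕
      (Σ a : (Σ p : X × X, (p.1 ⟶ p.2)), B a.1.1 × B a.1.2) → Sym K B :=
    Sum.elim const <| Sum.elim (fun p => comb p.1 p.2.1 p.2.2) <| Sum.elim ext <|
      Sum.elim (fun p => lift p.1 p.2) fun p => rel p.1 p.2.1 p.2.2
  have hφ : Function.Surjective φ := by
    rintro (x | ⟨x, r, s⟩ | a | ⟨a, i⟩ | ⟨a, i, j⟩)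
    · exact ⟨.inl x, rfl⟩
    · exact ⟨.inr (.inl (x, r, s)), rfl⟩
    · exact ⟨.inr (.inr (.inl a)), rfl⟩
    · exact ⟨.inr (.inr (.inr (.inl ⟨a, i⟩))), rfl⟩
    · exact ⟨.inr (.inr (.inr (.inr ⟨a, i, j⟩))), rfl⟩
  refine (mk_le_of_surjective hφ).trans ?_
  have hX' := mk_le_cardMor.trans hX
  simp only [mk_sum, lift_id]
  refine add_le_of_le hκ hX' <| add_le_of_le hκ ?_ <| add_le_of_le hκ hX <|
    add_le_of_le hκ (mk_sigma_le hκ hX fun _ => hB _) (mk_sigma_le hκ hX fun _ => ?_)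
  · simp only [mk_prod, lift_id]
    exact mul_le_of_le hκ hX' (mul_le_of_le hκ hK hK)
  · simp only [mk_prod, lift_id]
    exact mul_le_of_le hκ (hB _) (hB _)

end

end Sym

section

variable {K : Type u} [Field K] {X : Type u} [SmallCategory X] {F : X ⥤ CoalgCat.{u} K}

/-- With `extMap_counit`, this lets the single operation `ext` give closure under both the
contractions and the structure maps. -/
theorem extMap_id (M : TransContra F) (x : X) (f : F.obj x →ₗ[K] M.obj x) :
    Contra.extMap (F.map (𝟙 x)).toCoalgHom (M.map (𝟙 x)) f = (M.obj x).contr f :=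
  congrArg (M.obj x).contr (LinearMap.ext fun _ => M.map_id x _)

theorem extMap_counit (M : TransContra F) {x y : X} (α : x ⟶ y) (m : M.obj y) :
    Contra.extMap (F.map α).toCoalgHom (M.map α)
      ((Coalgebra.counit (R := K) (A := F.obj x)).smulRight m) = Contra.lin (M.map α) m := by
  refine Eq.trans (congrArg (M.obj x).contr ?_) ((M.obj x).contr_counit (Contra.lin (M.map α) m))
  exact LinearMap.ext fun c => (Contra.lin (M.map α)).map_smul _ m

/-- The operations generating a closed family of subspaces, from solutions of the equations
expressing that the trans-contramodule is cartesian. -/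
noncomputable def symOp (M : TransContra F) (s : ∀ x, M.obj x) {B : X → Type u}
    (b : ∀ x, Module.Basis (B x) K (F.obj x))
    (lift : ∀ x y : X, (x ⟶ y) → M.obj x → (F.obj x →ₗ[K] M.obj y))
    (rel : ∀ x y : X, (x ⟶ y) → (F.obj x →ₗ[K] M.obj y) → (F.obj x →ₗ[K] F.obj y →ₗ[K] M.obj y)) :
    ∀ a : Sym K B, (a.arity → M.obj a.src) → M.obj a.tgt
  | .const x, _ => s x
  | .comb x r t, f =>
      (r • (show M.obj x from f ⟨true⟩) + t • (show M.obj x from f ⟨false⟩) : M.obj x)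
  | .ext a, f => Contra.extMap (F.map a.2).toCoalgHom (M.map a.2)
      ((b a.1.1).constr K (show B a.1.1 → M.obj a.1.2 from f))
  | .lift a i, f => lift _ _ a.2 (f PUnit.unit) (b a.1.1 i)
  | .rel a i j, f =>
      rel _ _ a.2 ((b a.1.1).constr K (show B a.1.1 → M.obj a.1.2 from f)) (b a.1.1 i) (b a.1.2 j)

open Cardinal in
-- The seed `s` supplies an element in every sort, which makes each closed set nonempty and so gives
-- it `0` as the combination with zero coefficients.
theorem IsCartesian.exists_isCartClosed {M : TransContra F} (hM : M.IsCartesian)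
    (s : ∀ x, M.obj x) {κ μ : Cardinal.{u}} (hμ : ℵ₀ ≤ μ) (hμκ : μ ≤ κ) (hκμ : κ ^ μ ≤ κ)
    (hK : #K ≤ κ) (hX : cardMor X ≤ κ) (hF : ∀ x, Module.rank K (F.obj x) ≤ μ) :
    ∃ S : ∀ x, Submodule K (M.obj x), M.IsCartClosed S ∧ (∀ x, s x ∈ S x) ∧
      #(Σ x, S x) ≤ κ := by
  let B : X → Type u := fun x => Module.Basis.ofVectorSpaceIndex K (F.obj x)
  let b : ∀ x, Module.Basis (B x) K (F.obj x) := fun x => Module.Basis.ofVectorSpace K (F.obj x)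
  have hB : ∀ x, #(B x) ≤ μ := fun x => (b x).mk_eq_rank''.trans_le (hF x)
  have hM' := fun (x y : X) (α : x ⟶ y) => (Contra.isIso_extDesc_iff _ _).1 (hM α)
  choose lift hlift using fun (x y : X) (α : x ⟶ y) => (hM' x y α).1
  -- The operation must be defined for every `f`; outside the kernel of `extMap` the value `0` is
  -- arbitrary.
  have hrel' : ∀ (x y : X) (α : x ⟶ y) (f : F.obj x →ₗ[K] M.obj y),
      ∃ h, Contra.extMap (F.map α).toCoalgHom (M.map α) f = 0 →
        Contra.cohomRel (F.map α).toCoalgHom (M.obj y) h = f := fun x y α f => by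
    by_cases hf : Contra.extMap (F.map α).toCoalgHom (M.map α) f = 0
    · exact ((hM' x y α).2 f hf).imp fun _ h _ => h
    · exact ⟨0, fun h => (hf h).elim⟩
  choose rel hrel using hrel'
  have hκ := hμ.trans hμκ
  obtain ⟨T, hT, hop⟩ := exists_closed_family (fun x => M.obj x) Sym.arity Sym.src Sym.tgt
    (symOp M s b lift rel) (Sym.mk_le hκ hK hX fun x => (hB x).trans hμκ)
    (Sym.mk_arity_le hμ hB) hκμ hκ
  have hconst : ∀ x, s x ∈ T x := fun x => hop (.const x) PEmpty.elim fun i => i.elim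
  have hcomb : ∀ x (r t : K) (m n : M.obj x), m ∈ T x → n ∈ T x → r • m + t • n ∈ T x :=
    fun x r t m n hm hn => hop (.comb x r t) (fun i => if i.down then m else n) fun i => by
      rcases i with ⟨_ | _⟩
      · exact hn
      · exact hm
  let S : ∀ x, Submodule K (M.obj x) := fun x =>
    { carrier := T x
      add_mem' := fun {m n} hm hn => by simpa using hcomb x 1 1 m n hm hn
      zero_mem' := by simpa using hcomb x 0 0 _ _ (hconst x) (hconst x)
      smul_mem' := fun r m hm => by simpa using hcomb x r 0 m m hm hm }
  have hext : ∀ {x y : X} (α : x ⟶ y) (f : F.obj x →ₗ[K] M.obj y), (∀ c, f c ∈ S y) →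
      Contra.extMap (F.map α).toCoalgHom (M.map α) f ∈ S x := fun {x y} α f hf => by
    -- The operation only sees the values of `f` on the basis; `constr_self` rebuilds `f` from them.
    have := hop (.ext ⟨(x, y), α⟩) (fun i => f (b x i)) fun i => hf _
    change Contra.extMap (F.map α).toCoalgHom (M.map α) ((b x).constr K fun i => f (b x i)) ∈ S x
      at this
    rwa [(b x).constr_self] at this
  refine ⟨S, ⟨fun x g hg => ?_, fun {x y} α m hm => ?_, fun {x y} α n hn => ?_,
    fun {x y} α f hf h0 => ?_⟩, hconst, hT⟩
  · rw [← extMap_id]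
    exact hext _ _ hg
  · rw [← extMap_counit]
    exact hext _ _ fun c => (S y).smul_mem _ hm
  · exact ⟨lift x y α n, LinearMap.apply_mem_of_basis (b x) _ _ fun i =>
      hop (.lift ⟨(x, y), α⟩ i) (fun _ => n) fun _ => hn, hlift x y α n⟩
  · refine ⟨rel x y α f, fun c d => ?_, hrel x y α f h0⟩
    -- Reduction to pairs of basis vectors, first in `C_y` and then, after `flip`, in `C_x`; the
    -- symbols `rel` supply exactly these values.
    refine LinearMap.apply_mem_of_basis (b y) _ _ (fun j => ?_) d
    refine LinearMap.apply_mem_of_basis (b x) ((rel x y α f).flip (b y j)) _ (fun i => ?_) c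
    have := hop (.rel ⟨(x, y), α⟩ i j) (fun i => f (b x i)) fun i => hf _
    change rel x y α ((b x).constr K fun i => f (b x i)) (b x i) (b y j) ∈ S y at this
    rwa [(b x).constr_self] at this

open Cardinal in
/-- The bound `κ ^ μ` is large enough for the closure argument. -/
theorem IsCartesian.exists_isCartClosed_card_le {M : TransContra F} (hM : M.IsCartesian)
    (s : ∀ x, M.obj x) (lam : Cardinal.{u}) :
    ∃ S : ∀ x, Submodule K (M.obj x), M.IsCartClosed S ∧ (∀ x, s x ∈ S x) ∧
      #(Σ x, S x) ≤ kappa F lam ^ mu F := by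
  have hμ : ℵ₀ ≤ mu F := le_max_left _ _
  have hκ : ℵ₀ ≤ kappa F lam := (le_max_left _ _).trans ((le_max_left _ _).trans (le_max_left _ _))
  have hle : kappa F lam ≤ kappa F lam ^ mu F := self_le_power _ (one_le_aleph0.trans hμ)
  -- The bound is used with `κ ^ μ` in place of `κ`: then `μ < 2 ^ μ ≤ κ ^ μ`, and `μ * μ = μ` makes
  -- it stable under the power `μ`.
  refine hM.exists_isCartClosed s hμ ?_ ?_ ?_ ?_ fun x => ?_
  · exact (cantor _).le.trans (power_le_power_right ((natCast_lt_aleph0 (n := 2)).le.trans hκ))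
  · rw [← power_mul, mul_eq_self hμ]
  · exact (le_max_right _ _).trans ((le_max_left _ _).trans ((le_max_left _ _).trans hle))
  · exact (le_max_right _ _).trans ((le_max_right _ _).trans ((le_max_left _ _).trans hle))
  · exact (le_ciSup (f := fun x => Module.rank K (F.obj x)) bddAbove_of_small x).trans
      (le_max_right _ _)

end

end TransContra

/-! ### Structures on fixed carriers, which form a small type. -/

namespace Contra

/-- A contramodule structure on a given type. -/
structure On (K : Type u) [Field K] (C : Type u) [AddCommGroup C] [Module K C]
    [Coalgebra K C] (V : Type u) : Type u where
  [addCommGroup : AddCommGroup V]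
  [module : Module K V]
  contr : (C →ₗ[K] V) →ₗ[K] V
  contr_counit : ∀ m : V, contr ((Coalgebra.counit (R := K) (A := C)).smulRight m) = m
  contr_contr : ∀ g : C →ₗ[K] (C →ₗ[K] V),
    contr (contr ∘ₗ g) = contr (TensorProduct.lift g ∘ₗ Coalgebra.comul)

/-- The contramodule given by a structure on a type. -/
def On.toContra {K : Type u} [Field K] {C : Type u} [AddCommGroup C] [Module K C]
    [Coalgebra K C] {V : Type u} (A : On K C V) : Contra K C :=
  { A with carrier := V }

/-- The structure of a contramodule on its underlying type. -/
def toOn {K : Type u} [Field K] {C : Type u} [AddCommGroup C] [Module K C]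
    [Coalgebra K C] (M : Contra K C) : On K C M.carrier :=
  { M with }

end Contra

namespace TransContra

section

variable {K : Type u} [Field K] {X : Type u} [SmallCategory X] {F : X ⥤ CoalgCat.{u} K}

/-- A trans-contramodule structure on a given family of types. -/
structure On (F : X ⥤ CoalgCat.{u} K) (V : X → Type u) : Type u where
  obj : ∀ x : X, Contra.On K (F.obj x) (V x)
  map : ∀ {x y : X} (α : x ⟶ y),
    (obj y).toContra ⟶ Contra.restr (F.map α).toCoalgHom (obj x).toContra
  map_id : ∀ (x : X) (m : (obj x).toContra), Contra.lin (map (𝟙 x)) m = m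
  map_comp : ∀ {x y z : X} (α : x ⟶ y) (β : y ⟶ z) (m : (obj z).toContra),
    Contra.lin (map (α ≫ β)) m = Contra.lin (map α) (Contra.lin (map β) m)

/-- The trans-contramodule given by a structure on a family of types. -/
def On.toTransContra {V : X → Type u} (A : On F V) : TransContra F where
  obj x := (A.obj x).toContra
  map := A.map
  map_id := A.map_id
  map_comp := A.map_comp

/-- The structure of a trans-contramodule on its underlying family of types. -/
def toOn (M : TransContra F) : On F fun x => (M.obj x).carrier where
  obj x := (M.obj x).toOn
  map := M.map
  map_id := M.map_id
  map_comp := M.map_comp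

/-- Every element of a cartesian trans-contramodule lies in the image of one whose components
are subsets of a fixed type. -/
theorem IsCartesian.exists_on {M : TransContra F} (hM : M.IsCartesian) (x : X) (m : M.obj x) :
    ∃ (V : X → Set (kappa F Cardinal.aleph0 ^ mu F).out) (A : On F fun x => V x)
      (_ : A.toTransContra.IsCartesian) (i : A.toTransContra ⟶ M),
      m ∈ Set.range (Contra.lin (i.app x)) := by
  classical
  obtain ⟨S, hS, hs, hcard⟩ :=
    -- The seed is `m` at `x` and `0` elsewhere. The value `ℵ₀` is only a choice fixing one carrier
    -- set for all `M`.
    hM.exists_isCartClosed_card_le (Pi.single (M := fun x => M.obj x) x m) Cardinal.aleph0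
  have hm : m ∈ S x := by simpa using hs x
  have hemb : ∀ y, Nonempty (S y ↪ (kappa F Cardinal.aleph0 ^ mu F).out) := fun y => by
    rw [← Cardinal.le_def, Cardinal.mk_out]
    exact (Cardinal.mk_le_of_injective (f := fun t => (⟨y, t⟩ : Σ y, S y))
      fun _ _ h => eq_of_heq (Sigma.mk.inj h).2).trans hcard
  let ι := fun y => (hemb y).some
  let V : X → Set (kappa F Cardinal.aleph0 ^ mu F).out := fun y => Set.range (ι y)
  -- The vector space structure on the subset `V y` is transported from `S y` along this bijection,
  -- which thereby becomes linear.
  let e₀ : ∀ y, V y ≃ S y := fun y => (Equiv.ofInjective _ (ι y).injective).symm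
  let _ : ∀ y, AddCommGroup (V y) := fun y => (e₀ y).addCommGroup
  let _ : ∀ y, Module K (V y) := fun y => (e₀ y).module K
  let e : ∀ y, V y ≃ₗ[K] S y := fun y => (e₀ y).linearEquiv K
  exact ⟨V, (induced hS e).toOn, isCartesian_induced hS e, inducedIncl hS e,
    (e x).symm ⟨m, hm⟩, congrArg Subtype.val ((e x).apply_symm_apply ⟨m, hm⟩)⟩

end

end TransContra

/-! ### The set of generators and the cardinality bound. -/

theorem mainTheorem9 {K : Type u} [Field K] {X : Type u} [PartialOrder X]
    (F : X ⥤ CoalgCat.{u} K) (hF : RightCoflatRep F) :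
    (∃ (ι : Type u) (G : ι → CartTransContra F), (ObjectProperty.ofObj G).IsSeparating) ∧
    (∀ (lam : Cardinal.{u}) [Fact lam.IsRegular],
      (∀ x : X, IsCardinalPresentable (Contra.dual K (F.obj x)) lam) →
      ∀ (M : CartTransContra F) (x : X) (m : M.obj.obj x),
        ∃ (P : CartTransContra F) (i : P ⟶ M),
          (∀ y : X, Function.Injective (Contra.lin (i.hom.app y))) ∧
          m ∈ Set.range (Contra.lin (i.hom.app x)) ∧
          P.obj.card ≤ kappa F lam ^ mu F) := by
  classical
  constructor
  · refine ⟨Σ V : X → Set (kappa F Cardinal.aleph0 ^ mu F).out,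
      {A : TransContra.On F fun x => V x // A.toTransContra.IsCartesian},
      fun p => ⟨p.2.1.toTransContra, p.2.2⟩, fun M N f g h => ?_⟩
    apply ObjectProperty.hom_ext
    refine TransContra.Hom.ext (funext fun x => Contra.Hom.ext (LinearMap.ext fun m => ?_))
    -- Each element `m` is the image of some `v` in a generator, so equality of `f` and `g` after
    -- composing with `i` gives equality at `m`.
    obtain ⟨V, A, hA, i, v, rfl⟩ := TransContra.IsCartesian.exists_on M.property x m
    have := h _ ⟨⟨V, A, hA⟩⟩ (ObjectProperty.homMk i)
    exact congrArg (fun k => Contra.lin (TransContra.Hom.app (InducedCategory.Hom.hom k) x) v) this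
  · intro lam _ _ M x m
    obtain ⟨S, hS, hs, hcard⟩ := TransContra.IsCartesian.exists_isCartClosed_card_le M.property
      (Pi.single (M := fun x => M.obj.obj x) x m) lam
    have hm : m ∈ S x := by simpa using hs x
    let e : ∀ y, S y ≃ₗ[K] S y := fun y => LinearEquiv.refl K (S y)
    exact ⟨⟨TransContra.induced hS e, TransContra.isCartesian_induced hS e⟩,
      ObjectProperty.homMk (TransContra.inducedIncl hS e), TransContra.incl_injective e,
      ⟨⟨m, hm⟩, rfl⟩, hcard⟩
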